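/- For a nonzero polynomial $F\in\mathbb C[x,y]$ let $$\mathrm m(F)=\frac1{(2\pi i)^2}\iint_{|x|=|y|=1}\log|F(x,y)|\,\frac{dx}{x}\,\frac{dy}{y}$$ denote its (logarithmic) Mahler measure. For real $k$ put $$P_k(x,y)=(x^2+x+1)y^2+kx(x+1)y+x(x^2+x+1),\qquad R_k(x,y)=y^3-y+x^3-x+kxy.$$ Then for every real $k$ with $|k|\ge 16/(3\sqrt3)$ the two integrals defining $\mathrm m(P_k)$ and $\mathrm m(R_k)$ converge absolutely, and $\mathrm m(P_k)=\mathrm m(R_k)$. -/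

import Mathlib

noncomputable section

open MvPolynomial in
/-- The family `P_k(x, y) = (x² + x + 1) y² + k x (x + 1) y + x (x² + x + 1)`,
with `x = X 0` and `y = X 1`. -/
def polyP (k : ℝ) : MvPolynomial (Fin 2) ℂ :=
  (X 0 ^ 2 + X 0 + 1) * X 1 ^ 2 + C (k : ℂ) * X 0 * (X 0 + 1) * X 1
    + X 0 * (X 0 ^ 2 + X 0 + 1)

open MvPolynomial in
/-- The family `R_k(x, y) = y³ - y + x³ - x + k x y`, with `x = X 0` and `y = X 1`. -/
def polyR (k : ℝ) : MvPolynomial (Fin 2) ℂ :=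
  X 1 ^ 3 - X 1 + X 0 ^ 3 - X 0 + C (k : ℂ) * X 0 * X 1

/-- The function `(θ, φ) ↦ log |F(e^{iθ}, e^{iφ})|`. -/
def logNormOnTorus (F : MvPolynomial (Fin 2) ℂ) (p : ℝ × ℝ) : ℝ :=
  Real.log ‖MvPolynomial.eval
    ![Complex.exp ((p.1 : ℂ) * Complex.I), Complex.exp ((p.2 : ℂ) * Complex.I)] F‖

/-- One full period of the pair of angles parametrizing the torus `|x| = |y| = 1`. -/
def torusAngles : Set (ℝ × ℝ) :=
  Set.Icc (-Real.pi) Real.pi ×ˢ Set.Icc (-Real.pi) Real.pi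

/-- The (logarithmic) Mahler measure of a polynomial in two variables,
`m(F) = (2πi)⁻² ∬_{|x| = |y| = 1} log |F(x, y)| (dx/x) (dy/y)`,
written in the angles `x = e^{iθ}`, `y = e^{iφ}`, where `dx/x = i dθ` and `dy/y = i dφ`. -/
def logMahlerMeasure₂ (F : MvPolynomial (Fin 2) ℂ) : ℝ :=
  1 / (2 * Real.pi) ^ 2 * ∫ p in torusAngles, logNormOnTorus F p

end

section

open MeasureTheory Set Real Filter Topology

/-! A monomial substitution of determinant ±2 preserves averages over the torus and turns each
polynomial, up to a unimodular factor, into a quadratic in `e^{iφ}` whose real coefficients depend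
on the other angle `t` (`logNormOnTorus_polyP`, `logNormOnTorus_polyR`). Jensen's formula evaluates
the inner integral, leaving the single integrals of `fiberP |k|` and `fiberR |k|`. The threshold `16
/ (3√3)` is what makes the `polyR` quadratic have one root in the closed disc and one outside or on
the circle for almost every `t`; everything after that needs only `k > 3`.

The `k`-derivatives of the two single integrals are elliptic integrals. In the coordinate `s = cos²
t` they are twice the integrals over `(0, 1)` of `1/√((1 - s)(k²s - (4s - 1)²))`, restricted to
where the radicand is positive, and of `1/√(s(1 - s)(k² - 48s + 64s²))`. The degree-two rational map
`isogenyMap` pulls the first differential back to twice the second, and each of its two monotone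
branches covers the support of the first exactly once, so the integrals agree
(`lintegral_densityP_eq_lintegral_densityR`).

Hence the difference of the two measures is constant in `k`. As `k → ∞` both single integrals are
`2π log k + o(1)`, for `polyP` because `log |2 cos t|` has mean zero, so the constant is zero.
Derivatives are integrated as Lebesgue integrals of nonnegative functions, so Tonelli applies with
no integrability checks. -/

/-- Lebesgue measure on one period of the angle. -/
noncomputable def angleMeasure : Measure ℝ := volume.restrict (Ioc (-π) π)

instance : IsFiniteMeasure angleMeasure := by
  unfold angleMeasure; infer_instance

lemma angleMeasure_univ : angleMeasure univ = ENNReal.ofReal (2 * π) := by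
  simp [angleMeasure, two_mul]

lemma measureReal_angleMeasure_univ : angleMeasure.real univ = 2 * π := by
  rw [Measure.real, angleMeasure_univ, ENNReal.toReal_ofReal (by positivity)]

/-! ### Jensen's formula for quadratics with real coefficients -/

namespace Polynomial

lemma periodic_log_norm_eval_exp (p : ℂ[X]) :
    Function.Periodic (fun φ : ℝ ↦ Real.log ‖p.eval (Complex.exp (φ * Complex.I))‖) (2 * π) := by
  intro φ
  have h := Complex.exp_mul_I_periodic (φ : ℂ)
  simp only [Complex.ofReal_add, Complex.ofReal_mul, Complex.ofReal_ofNat]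
  exact congrArg (fun z ↦ Real.log ‖p.eval z‖) h

lemma integrable_log_norm_eval_exp (p : ℂ[X]) :
    Integrable (fun φ : ℝ ↦ Real.log ‖p.eval (Complex.exp (φ * Complex.I))‖) angleMeasure := by
  have h := p.intervalIntegrable_mahlerMeasure
  simp only [circleMap, zero_add, Complex.ofReal_one, one_mul] at h
  have h2 := (p.periodic_log_norm_eval_exp.intervalIntegrable₀ (by positivity) h (-π) π)
  rw [intervalIntegrable_iff_integrableOn_Ioc_of_le (by linarith [pi_pos])] at h2
  exact h2

lemma integral_log_norm_eval_exp (p : ℂ[X]) :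
    ∫ φ : ℝ, Real.log ‖p.eval (Complex.exp (φ * Complex.I))‖ ∂angleMeasure
      = 2 * π * p.logMahlerMeasure := by
  have h := p.periodic_log_norm_eval_exp.intervalIntegral_add_eq 0 (-π)
  rw [logMahlerMeasure_def, circleAverage_def]
  simp only [circleMap, zero_add, Complex.ofReal_one, one_mul] at h ⊢
  rw [h, show -π + 2 * π = π by ring, intervalIntegral.integral_of_le (by linarith [pi_pos]),
    angleMeasure, smul_eq_mul,
    mul_inv_cancel_left₀ (by positivity)]

lemma logMahlerMeasure_quadratic {a : ℂ} (ha : a ≠ 0) (r s : ℂ) :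
    (C a * ((X - C r) * (X - C s))).logMahlerMeasure
      = Real.log ‖a‖ + (log⁺ ‖r‖ + log⁺ ‖s‖) := by
  have h := mul_ne_zero (X_sub_C_ne_zero r) (X_sub_C_ne_zero s)
  rw [logMahlerMeasure_C_mul ha h, logMahlerMeasure_mul_eq_add_logMahlerMeasure h,
    logMahlerMeasure_X_sub_C, logMahlerMeasure_X_sub_C]

/-- A real quadratic polynomial `A X² + B X + C`, with complex coefficients. -/
noncomputable def realQuadratic (A B D : ℝ) : ℂ[X] := C (A : ℂ) * X ^ 2 + C (B : ℂ) * X + C (D : ℂ)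

lemma eval_realQuadratic (A B D : ℝ) (z : ℂ) :
    (realQuadratic A B D).eval z = A * z ^ 2 + B * z + D := by
  simp [realQuadratic]

lemma realQuadratic_eq {A B D : ℝ} (hA : A ≠ 0) {δ : ℂ} (hδ : δ ^ 2 = B ^ 2 - 4 * A * D) :
    realQuadratic A B D = C (A : ℂ) *
      ((X - C ((-B + δ) / (2 * A))) * (X - C ((-B - δ) / (2 * A)))) := by
  have hA' : (A : ℂ) ≠ 0 := by exact_mod_cast hA
  have h1 : (B : ℂ) = -A * ((-B + δ) / (2 * A) + (-B - δ) / (2 * A)) := by field_simp; ring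
  have h2 : (D : ℂ) = A * ((-B + δ) / (2 * A) * ((-B - δ) / (2 * A))) := by
    field_simp; linear_combination hδ
  rw [realQuadratic]
  generalize (-B + δ) / (2 * A) = r at *
  generalize (-B - δ) / (2 * A) = s at *
  rw [h1, h2]
  simp only [C_mul, C_add, C_neg]
  ring

/-- The hypothesis says that the values at `1` and `-1` have product `(A + D)² - B² ≤ 0`. The roots
are then real, one in `[-1, 1]` and the other of modulus at least `1`; only the latter contributes.
-/
lemma logMahlerMeasure_realQuadratic_of_abs_add_le {A B D : ℝ} (hA : A ≠ 0)
    (h : |A + D| ≤ |B|) :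
    (realQuadratic A B D).logMahlerMeasure
      = Real.log ((|B| + √(B ^ 2 - 4 * A * D)) / 2) := by
  wlog hB : 0 ≤ B generalizing B with H
  -- Changing the sign of `B` negates both roots, which leaves their moduli alone.
  · have key : (realQuadratic A B D).logMahlerMeasure
        = (realQuadratic A (-B) D).logMahlerMeasure := by
      have hsq : (B : ℂ) ^ 2 - 4 * A * D = (-B : ℝ) ^ 2 - 4 * A * D := by push_cast; ring
      obtain ⟨δ, hδ⟩ := IsAlgClosed.exists_pow_nat_eq ((B : ℂ) ^ 2 - 4 * A * D) (n := 2) (by norm_num)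
      rw [realQuadratic_eq hA hδ, realQuadratic_eq hA (hδ.trans hsq),
        logMahlerMeasure_quadratic (by exact_mod_cast hA),
        logMahlerMeasure_quadratic (by exact_mod_cast hA)]
      have e1 : ‖(-((-B : ℝ) : ℂ) + δ) / (2 * A)‖ = ‖(-B - δ) / (2 * A)‖ := by
        rw [← norm_neg]; congr 1; push_cast; ring
      have e2 : ‖(-((-B : ℝ) : ℂ) - δ) / (2 * A)‖ = ‖(-B + δ) / (2 * A)‖ := by
        rw [← norm_neg]; congr 1; push_cast; ring
      rw [e1, e2]; ring
    rw [key, H (by simpa using h) (by linarith)]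
    simp
  rw [abs_of_nonneg hB] at h ⊢
  have hAp : 0 < |A| := abs_pos.mpr hA
  have hdisc : (A - D) ^ 2 ≤ B ^ 2 - 4 * A * D := by
    nlinarith [sq_le_sq' (by linarith [abs_nonneg (A + D)]) h, sq_abs (A + D)]
  set S := √(B ^ 2 - 4 * A * D) with hS
  have hSS : S ^ 2 = B ^ 2 - 4 * A * D := sq_sqrt (le_trans (sq_nonneg _) hdisc)
  have hS0 : 0 ≤ S := sqrt_nonneg _
  have hAD : |A - D| ≤ S := by
    rw [hS, ← sqrt_sq_eq_abs]; exact sqrt_le_sqrt hdisc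
  have hbig : 2 * |A| ≤ B + S := by
    have : |2 * A| ≤ |A + D| + |A - D| := by
      have := abs_add_le (A + D) (A - D); rwa [show A + D + (A - D) = 2 * A by ring] at this
    rw [abs_mul, abs_two] at this; linarith
  have hprod : |A * (A + D)| ≤ |A| * B := by rw [abs_mul]; gcongr
  have hprod' := abs_le.mp hprod
  have hA2 := sq_abs A
  have hsmall : |B - S| ≤ 2 * |A| := by
    rw [abs_le]
    constructor
    · have : S ≤ B + 2 * |A| := by
        refine (pow_le_pow_iff_left₀ (by positivity) (by positivity) two_ne_zero).mp ?_
        nlinarith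
      linarith
    · by_contra! hc
      have : B - 2 * |A| ≤ S := by
        refine (pow_le_pow_iff_left₀ (by linarith) hS0 two_ne_zero).mp ?_
        nlinarith
      linarith
  have hδ : ((S : ℝ) : ℂ) ^ 2 = (B : ℂ) ^ 2 - 4 * A * D := by exact_mod_cast hSS
  rw [realQuadratic_eq hA hδ, logMahlerMeasure_quadratic (by exact_mod_cast hA)]
  have e1 : ‖(-(B : ℂ) + S) / (2 * A)‖ = |B - S| / (2 * |A|) := by
    rw [show (-(B : ℂ) + S) / (2 * A) = (((-B + S) / (2 * A) : ℝ) : ℂ) by push_cast; ring,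
      Complex.norm_real, Real.norm_eq_abs, abs_div, abs_mul, abs_two, ← abs_neg]
    congr 2; ring
  have e2 : ‖(-(B : ℂ) - S) / (2 * A)‖ = (B + S) / (2 * |A|) := by
    rw [show (-(B : ℂ) - S) / (2 * A) = (((-B - S) / (2 * A) : ℝ) : ℂ) by push_cast; ring,
      Complex.norm_real, Real.norm_eq_abs, abs_div, abs_mul, abs_two, ← abs_neg,
      show -(-B - S) = B + S by ring, abs_of_nonneg (by positivity)]
  rw [e1, e2, Complex.norm_real, Real.norm_eq_abs,
    (posLog_eq_zero_iff _).mpr, posLog_eq_log, zero_add, ← Real.log_mul hAp.ne'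
      (div_pos (by linarith) (by positivity)).ne']
  · congr 1; field_simp
  · rw [abs_of_nonneg (by positivity), le_div_iff₀ (by positivity)]; linarith
  · rw [abs_of_nonneg (by positivity), div_le_one (by positivity)]; linarith

/-- The discriminant is nonpositive and the root product is `1`, so both roots lie on the unit
circle. -/
lemma logMahlerMeasure_realQuadratic_of_abs_le {A B : ℝ} (hA : A ≠ 0) (h : |B| ≤ 2 * |A|) :
    (realQuadratic A B A).logMahlerMeasure = Real.log |A| := by
  have hAp : 0 < |A| := abs_pos.mpr hA
  have hD : 0 ≤ 4 * A ^ 2 - B ^ 2 := by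
    nlinarith [sq_abs A, sq_abs B, abs_nonneg B, mul_self_le_mul_self (abs_nonneg B) h]
  set S := √(4 * A ^ 2 - B ^ 2)
  have hSS : S ^ 2 = 4 * A ^ 2 - B ^ 2 := sq_sqrt hD
  have hδ : ((S : ℂ) * Complex.I) ^ 2 = (B : ℂ) ^ 2 - 4 * A * A := by
    rw [mul_pow, Complex.I_sq]
    have : (S : ℂ) ^ 2 = 4 * A ^ 2 - B ^ 2 := by exact_mod_cast hSS
    rw [this]; ring
  have nrm : ∀ T : ℝ, T ^ 2 = S ^ 2 → ‖(-(B : ℂ) + T * Complex.I) / (2 * A)‖ = 1 := by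
    intro T hT
    rw [norm_div, norm_mul, Complex.norm_real, Real.norm_eq_abs,
      show (-(B : ℂ) + T * Complex.I) = ((-B : ℝ) : ℂ) + T * Complex.I by push_cast; ring,
      Complex.norm_add_mul_I, neg_sq, hT, hSS, show B ^ 2 + (4 * A ^ 2 - B ^ 2) = (2 * A) ^ 2 by ring,
      sqrt_sq_eq_abs, abs_mul, abs_two, Complex.norm_ofNat]
    field_simp
  rw [realQuadratic_eq hA hδ, logMahlerMeasure_quadratic (by exact_mod_cast hA), nrm S rfl]
  have := nrm (-S) (by ring)
  rw [show (-(B : ℂ) - S * Complex.I) = -(B : ℂ) + ((-S : ℝ) : ℂ) * Complex.I by push_cast; ring,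
    this]
  simp

lemma log_abs_le_logMahlerMeasure_realQuadratic {A B D : ℝ} (hA : A ≠ 0) :
    Real.log |A| ≤ (realQuadratic A B D).logMahlerMeasure := by
  have h := leadingCoeff_le_mahlerMeasure (realQuadratic A B D)
  have hl : (realQuadratic A B D).leadingCoeff = A :=
    leadingCoeff_quadratic (by exact_mod_cast hA)
  rw [hl, Complex.norm_real, Real.norm_eq_abs] at h
  rw [logMahlerMeasure_eq_log_MahlerMeasure]
  exact Real.log_le_log (abs_pos.mpr hA) h

end Polynomial

/-! ### Monomial changes of variable on the torus -/

lemma volume_restrict_torusAngles :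
    (volume : Measure (ℝ × ℝ)).restrict torusAngles = angleMeasure.prod angleMeasure := by
  rw [torusAngles, Measure.volume_eq_prod, ← Measure.prod_restrict, angleMeasure,
    ← restrict_Ioc_eq_restrict_Icc]

/-- The period `2 π` of the additive circle is positive. -/
instance fact_two_pi_pos : Fact (0 < 2 * π) := ⟨by positivity⟩

lemma measurePreserving_coe_addCircle :
    MeasurePreserving (fun x : ℝ ↦ (x : AddCircle (2 * π))) angleMeasure volume := by
  have h := AddCircle.measurePreserving_mk (2 * π) (-π)
  rwa [show -π + 2 * π = π by ring] at h

lemma measurePreserving_coe_addCircle_prod :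
    MeasurePreserving (Prod.map (fun x : ℝ ↦ (x : AddCircle (2 * π)))
      (fun x : ℝ ↦ (x : AddCircle (2 * π)))) (angleMeasure.prod angleMeasure) volume :=
  measurePreserving_coe_addCircle.prod measurePreserving_coe_addCircle

lemma exists_two_nsmul_addCircle (p : AddCircle (2 * π)) : ∃ a, a + a = p := by
  induction p using QuotientAddGroup.induction_on with
  | H x => exact ⟨((x / 2 : ℝ) : AddCircle (2 * π)), by rw [← AddCircle.coe_add, add_halves]⟩

/-- The logarithm of the norm of a two-variable polynomial at a point of the additive torus. -/
noncomputable def logNormOnAddTorus (F : MvPolynomial (Fin 2) ℂ)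
    (p : AddCircle (2 * π) × AddCircle (2 * π)) : ℝ :=
  Real.log ‖MvPolynomial.eval ![(AddCircle.toCircle p.1 : ℂ), (AddCircle.toCircle p.2 : ℂ)] F‖

lemma measurable_logNormOnAddTorus (F : MvPolynomial (Fin 2) ℂ) :
    Measurable (logNormOnAddTorus F) := by
  refine Real.measurable_log.comp (Continuous.measurable (Continuous.norm ?_))
  refine (MvPolynomial.continuous_eval F).comp (continuous_pi fun i ↦ ?_)
  have h := (AddCircle.continuous_toCircle (T := 2 * π))
  fin_cases i
  · exact continuous_subtype_val.comp (h.comp continuous_fst)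
  · exact continuous_subtype_val.comp (h.comp continuous_snd)

lemma toCircle_coe_two_pi (x : ℝ) :
    ((AddCircle.toCircle (x : AddCircle (2 * π)) : Circle) : ℂ)
      = Complex.exp (x * Complex.I) := by
  rw [AddCircle.toCircle_apply_mk, div_self (by positivity), one_mul, Circle.coe_exp]

lemma logNormOnAddTorus_coe (F : MvPolynomial (Fin 2) ℂ) (x y : ℝ) :
    logNormOnAddTorus F (x, y) = logNormOnTorus F (x, y) := by
  simp only [logNormOnAddTorus, toCircle_coe_two_pi, logNormOnTorus]

/-- Integration over the torus is invariant under a surjective endomorphism. -/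
lemma torus_endomorphism (F : MvPolynomial (Fin 2) ℂ)
    (φ : AddCircle (2 * π) × AddCircle (2 * π) →+ AddCircle (2 * π) × AddCircle (2 * π))
    (hφ : Continuous φ) (hs : Function.Surjective φ) (ψ : ℝ × ℝ → ℝ × ℝ)
    (hψ : ∀ x y : ℝ, φ (x, y) = (((ψ (x, y)).1 : AddCircle (2 * π)), ((ψ (x, y)).2 : AddCircle (2 * π)))) :
    (IntegrableOn (logNormOnTorus F) torusAngles ↔
      Integrable (fun p ↦ logNormOnTorus F (ψ p)) (angleMeasure.prod angleMeasure)) ∧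
    ∫ p in torusAngles, logNormOnTorus F p
      = ∫ p, logNormOnTorus F (ψ p) ∂(angleMeasure.prod angleMeasure) := by
  have hT := measurePreserving_coe_addCircle_prod
  have : (volume : Measure (AddCircle (2 * π) × AddCircle (2 * π))).IsAddHaarMeasure :=
    inferInstanceAs ((volume : Measure (AddCircle (2 * π))).prod volume).IsAddHaarMeasure
  -- A continuous surjective endomorphism of a compact group sends Haar measure to an invariant
  -- measure of the same total mass; injectivity is not needed.
  have hφ' : MeasurePreserving φ volume volume :=
    AddMonoidHom.measurePreserving hφ hs rfl
  have hG := measurable_logNormOnAddTorus F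
  have e1 : logNormOnTorus F = logNormOnAddTorus F ∘ Prod.map (fun x : ℝ ↦ (x : AddCircle (2 * π)))
      (fun x : ℝ ↦ (x : AddCircle (2 * π))) := by
    ext ⟨x, y⟩; exact (logNormOnAddTorus_coe F x y).symm
  have e2 : (fun p ↦ logNormOnTorus F (ψ p)) = logNormOnAddTorus F ∘ (φ ∘
      Prod.map (fun x : ℝ ↦ (x : AddCircle (2 * π))) (fun x : ℝ ↦ (x : AddCircle (2 * π)))) := by
    ext ⟨x, y⟩
    simp only [Function.comp, Prod.map, hψ, logNormOnAddTorus_coe]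
  have hc := hφ'.comp hT
  rw [IntegrableOn, volume_restrict_torusAngles, e1]
  constructor
  · rw [hT.integrable_comp hG.aestronglyMeasurable, ← e1, e2,
      hc.integrable_comp hG.aestronglyMeasurable]
  · rw [← e1, e2]
    rw [e1]
    simp only [Function.comp_def (logNormOnAddTorus F)]
    rw [← integral_map hT.measurable.aemeasurable hG.aestronglyMeasurable,
      ← integral_map hc.measurable.aemeasurable hG.aestronglyMeasurable, hT.map_eq, hc.map_eq]

lemma torus_double_add (F : MvPolynomial (Fin 2) ℂ) :
    (IntegrableOn (logNormOnTorus F) torusAngles ↔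
      Integrable (fun p ↦ logNormOnTorus F (p.1 + p.1, p.1 + p.2))
        (angleMeasure.prod angleMeasure)) ∧
    ∫ p in torusAngles, logNormOnTorus F p
      = ∫ p, logNormOnTorus F (p.1 + p.1, p.1 + p.2) ∂(angleMeasure.prod angleMeasure) := by
  refine torus_endomorphism F
    (AddMonoidHom.prod (AddMonoidHom.fst _ _ + AddMonoidHom.fst _ _) (AddMonoidHom.fst _ _ + AddMonoidHom.snd _ _))
    ?_ ?_ (fun p ↦ (p.1 + p.1, p.1 + p.2)) ?_
  · change Continuous fun p : AddCircle (2 * π) × AddCircle (2 * π) ↦ (p.1 + p.1, p.1 + p.2)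
    fun_prop
  · rintro ⟨p, q⟩
    obtain ⟨a, ha⟩ := exists_two_nsmul_addCircle p
    exact ⟨(a, q - a), by simp [ha]⟩
  · intro x y; simp

lemma torus_add_sub (F : MvPolynomial (Fin 2) ℂ) :
    (IntegrableOn (logNormOnTorus F) torusAngles ↔
      Integrable (fun p ↦ logNormOnTorus F (p.2 + p.1, p.2 - p.1))
        (angleMeasure.prod angleMeasure)) ∧
    ∫ p in torusAngles, logNormOnTorus F p
      = ∫ p, logNormOnTorus F (p.2 + p.1, p.2 - p.1) ∂(angleMeasure.prod angleMeasure) := by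
  refine torus_endomorphism F
    (AddMonoidHom.prod (AddMonoidHom.snd _ _ + AddMonoidHom.fst _ _) (AddMonoidHom.snd _ _ - AddMonoidHom.fst _ _))
    ?_ ?_ (fun p ↦ (p.2 + p.1, p.2 - p.1)) ?_
  · change Continuous fun p : AddCircle (2 * π) × AddCircle (2 * π) ↦ (p.2 + p.1, p.2 - p.1)
    fun_prop
  · rintro ⟨p, q⟩
    obtain ⟨a, ha⟩ := exists_two_nsmul_addCircle (p - q)
    refine ⟨(a, q + a), ?_⟩
    simp only [AddMonoidHom.prod_apply, AddMonoidHom.add_apply, AddMonoidHom.sub_apply,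
      AddMonoidHom.coe_fst, AddMonoidHom.coe_snd, Prod.mk.injEq]
    constructor
    · rw [add_assoc, ha]; abel
    · abel
  · intro x y; simp

/-! ### Both families as real quadratics on each fibre -/

/-- The logarithm of the norm of a quadratic polynomial with real coefficients, at a point
of the unit circle. -/
noncomputable def logNormQuadratic (A B D φ : ℝ) : ℝ :=
  Real.log ‖(Polynomial.realQuadratic A B D).eval (Complex.exp (φ * Complex.I))‖

/-- With `u = e^{it}`, `v = e^{iφ}`, the value of `polyP k` at `(u², uv)` is `u⁴` times the
quadratic in `v`, since `u² + 1 + u⁻² = 4 cos² t - 1`. -/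
lemma logNormOnTorus_polyP (k t φ : ℝ) :
    logNormOnTorus (polyP k) (t + t, t + φ)
      = logNormQuadratic (4 * cos t ^ 2 - 1) (2 * k * cos t) (4 * cos t ^ 2 - 1) φ := by
  rw [logNormOnTorus, logNormQuadratic, Polynomial.eval_realQuadratic]
  have hu : Complex.exp (t * Complex.I) ≠ 0 := Complex.exp_ne_zero _
  have hc : (Complex.cos t) = (Complex.exp (t * Complex.I) + (Complex.exp (t * Complex.I))⁻¹) / 2 := by
    rw [Complex.cos, neg_mul, Complex.exp_neg]
  have hn : ‖Complex.exp (t * Complex.I)‖ = 1 := Complex.norm_exp_ofReal_mul_I t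
  have e1 : Complex.exp (((t + t : ℝ) : ℂ) * Complex.I) = Complex.exp (t * Complex.I) ^ 2 := by
    rw [← Complex.exp_nat_mul]; congr 1; push_cast; ring
  have e2 : Complex.exp (((t + φ : ℝ) : ℂ) * Complex.I)
      = Complex.exp (t * Complex.I) * Complex.exp (φ * Complex.I) := by
    rw [← Complex.exp_add]; congr 1; push_cast; ring
  simp only [polyP, map_add, map_mul, map_pow, MvPolynomial.eval_X, MvPolynomial.eval_C, map_one,
    Matrix.cons_val_zero, Matrix.cons_val_one, e1, e2]
  push_cast
  rw [hc]
  set u := Complex.exp (t * Complex.I)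
  set v := Complex.exp (φ * Complex.I)
  rw [← one_mul ‖(_ : ℂ)‖, ← one_mul ‖((_ - 1 : ℂ) * _ + _)+_‖]
  conv_rhs => rw [← one_pow 4, ← hn, ← norm_pow, ← norm_mul]
  rw [one_mul]
  congr 2
  field_simp
  ring

/-- With `u = e^{iφ}`, `v = e^{it}`, the value of `polyR k` at `(uv, u/v)` is `u` times the
quadratic in `u`, the cubes giving `2 cos 3t`. -/
lemma logNormOnTorus_polyR (k t φ : ℝ) :
    logNormOnTorus (polyR k) (φ + t, φ - t)
      = logNormQuadratic (2 * cos (3 * t)) k (-(2 * cos t)) φ := by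
  rw [logNormOnTorus, logNormQuadratic, Polynomial.eval_realQuadratic]
  have hv : Complex.exp (t * Complex.I) ≠ 0 := Complex.exp_ne_zero _
  have hc : (Complex.cos t) = (Complex.exp (t * Complex.I) + (Complex.exp (t * Complex.I))⁻¹) / 2 := by
    rw [Complex.cos, neg_mul, Complex.exp_neg]
  have hn : ‖Complex.exp (φ * Complex.I)‖ = 1 := Complex.norm_exp_ofReal_mul_I φ
  have e1 : Complex.exp (((φ + t : ℝ) : ℂ) * Complex.I)
      = Complex.exp (φ * Complex.I) * Complex.exp (t * Complex.I) := by
    rw [← Complex.exp_add]; congr 1; push_cast; ring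
  have e2 : Complex.exp (((φ - t : ℝ) : ℂ) * Complex.I)
      = Complex.exp (φ * Complex.I) * (Complex.exp (t * Complex.I))⁻¹ := by
    rw [← Complex.exp_neg, ← Complex.exp_add]; congr 1; push_cast; ring
  simp only [polyR, map_add, map_sub, map_mul, map_pow, MvPolynomial.eval_X, MvPolynomial.eval_C,
    Matrix.cons_val_zero, Matrix.cons_val_one, e1, e2, cos_three_mul]
  push_cast
  rw [hc]
  set u := Complex.exp (φ * Complex.I)
  set v := Complex.exp (t * Complex.I)
  conv_rhs => rw [← one_mul ‖(_ : ℂ)‖, ← hn, ← norm_mul]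
  congr 2
  field_simp
  ring

/-! ### Integrability on the torus and Fubini -/

/-- A family of real quadratic polynomials whose leading coefficient has an integrable logarithm
is log-integrable on the torus. -/
lemma integrable_logNormQuadratic {A B D : ℝ → ℝ} (hA : Continuous A) (hB : Continuous B)
    (hD : Continuous D) (hA0 : ∀ᵐ t ∂angleMeasure, A t ≠ 0)
    (hAi : Integrable (fun t ↦ Real.log |A t|) angleMeasure) :
    Integrable (fun p : ℝ × ℝ ↦ logNormQuadratic (A p.1) (B p.1) (D p.1) p.2)
      (angleMeasure.prod angleMeasure) := by
  have hmeas : Measurable (fun p : ℝ × ℝ ↦ logNormQuadratic (A p.1) (B p.1) (D p.1) p.2) := by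
    unfold logNormQuadratic
    simp only [Polynomial.eval_realQuadratic]
    refine Real.measurable_log.comp (Continuous.measurable ?_)
    fun_prop
  obtain ⟨M, hM⟩ : ∃ M, ∀ t ∈ Icc (-π) π, |A t| + |B t| + |D t| ≤ M := by
    obtain ⟨M, hM⟩ := isCompact_Icc.exists_bound_of_continuousOn (s := Icc (-π) π)
      (f := fun t ↦ |A t| + |B t| + |D t|) (by fun_prop)
    exact ⟨M, fun t ht ↦ (le_abs_self _).trans (hM t ht)⟩
  set L := max (Real.log M) 0
  have hle : ∀ t ∈ Icc (-π) π, ∀ φ, logNormQuadratic (A t) (B t) (D t) φ ≤ L := by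
    intro t ht φ
    rw [logNormQuadratic, Polynomial.eval_realQuadratic]
    set z := Complex.exp (φ * Complex.I)
    have hz : ‖z‖ = 1 := Complex.norm_exp_ofReal_mul_I φ
    by_cases h0 : ‖(A t : ℂ) * z ^ 2 + B t * z + D t‖ = 0
    · rw [h0, Real.log_zero]; exact le_max_right _ _
    refine le_trans (Real.log_le_log (by positivity) (le_trans ?_ (hM t ht))) (le_max_left _ _)
    refine (norm_add₃_le).trans ?_
    simp [hz]
  rw [integrable_prod_iff hmeas.aestronglyMeasurable]
  refine ⟨Eventually.of_forall fun t ↦ Polynomial.integrable_log_norm_eval_exp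
    (Polynomial.realQuadratic (A t) (B t) (D t)), ?_⟩
  refine Integrable.mono' (g := fun t ↦ 2 * L * (2 * π) + 2 * π * abs (Real.log |A t|)) ?_ ?_ ?_
  · exact (integrable_const _).add (hAi.abs.const_mul _)
  · exact hmeas.norm.aestronglyMeasurable.integral_prod_right'
  · have hmem : ∀ᵐ t ∂angleMeasure, t ∈ Ioc (-π) π := ae_restrict_mem measurableSet_Ioc
    filter_upwards [hA0, hmem] with t ht htm
    rw [Real.norm_eq_abs, abs_of_nonneg (integral_nonneg fun _ ↦ norm_nonneg _)]
    have hi : Integrable (logNormQuadratic (A t) (B t) (D t)) angleMeasure :=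
      Polynomial.integrable_log_norm_eval_exp _
    have hI : ∫ φ, logNormQuadratic (A t) (B t) (D t) φ ∂angleMeasure = _ :=
      Polynomial.integral_log_norm_eval_exp _
    -- Since `f ≤ L` with `L ≥ 0`, one has `|f| ≤ 2L - f`. The integral of `f` is `2π` times a
    -- Mahler measure, which is at least `log |A t|`.
    calc ∫ φ, ‖logNormQuadratic (A t) (B t) (D t) φ‖ ∂angleMeasure
        ≤ ∫ φ, (2 * L - logNormQuadratic (A t) (B t) (D t) φ) ∂angleMeasure := by
          refine integral_mono hi.norm ((integrable_const _).sub hi) fun φ ↦ ?_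
          have h1 := hle t (Ioc_subset_Icc_self htm) φ
          have h2 : 0 ≤ L := le_max_right _ _
          simp only [Real.norm_eq_abs]
          rw [abs_le]; constructor <;> linarith
      _ = 2 * L * (2 * π) - 2 * π * (Polynomial.realQuadratic (A t) (B t) (D t)).logMahlerMeasure := by
          rw [integral_sub (integrable_const _) hi, hI, integral_const, measureReal_angleMeasure_univ,
            smul_eq_mul, mul_comm (2 * π)]
      _ ≤ _ := by
          have h := Polynomial.log_abs_le_logMahlerMeasure_realQuadratic (B := B t) (D := D t) ht
          have h3 := neg_abs_le (Real.log |A t|)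
          have : 2 * π * -abs (Real.log |A t|) ≤
            2 * π * (Polynomial.realQuadratic (A t) (B t) (D t)).logMahlerMeasure := by
            gcongr; linarith
          linarith

lemma integral_logNormQuadratic {A B D : ℝ → ℝ}
    (h : Integrable (fun p : ℝ × ℝ ↦ logNormQuadratic (A p.1) (B p.1) (D p.1) p.2)
      (angleMeasure.prod angleMeasure)) :
    ∫ p : ℝ × ℝ, logNormQuadratic (A p.1) (B p.1) (D p.1) p.2 ∂(angleMeasure.prod angleMeasure)
      = 2 * π * ∫ t, (Polynomial.realQuadratic (A t) (B t) (D t)).logMahlerMeasure ∂angleMeasure ∧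
    Integrable (fun t ↦ (Polynomial.realQuadratic (A t) (B t) (D t)).logMahlerMeasure)
      angleMeasure := by
  have e : ∀ t, ∫ φ, logNormQuadratic (A t) (B t) (D t) φ ∂angleMeasure = _ :=
    fun t ↦ Polynomial.integral_log_norm_eval_exp _
  constructor
  · rw [integral_prod _ h]
    simp only [e, integral_const_mul]
  · have := h.integral_prod_left
    simp only [e] at this
    have h2 := this.const_mul (2 * π)⁻¹
    simpa [← mul_assoc, pi_ne_zero] using h2

lemma ae_eval_exp_ne_zero {p : Polynomial ℂ} (hp : p ≠ 0) :
    ∀ᵐ t : ℝ ∂angleMeasure, p.eval (Complex.exp (t * Complex.I)) ≠ 0 := by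
  refine (ae_restrict_iff' measurableSet_Ioc).mpr (ae_iff.mpr ?_)
  refine Set.Finite.measure_zero (s := {t : ℝ | ¬ (t ∈ Ioc (-π) π →
    p.eval (Complex.exp (t * Complex.I)) ≠ 0)}) ?_ _
  refine Set.Finite.of_finite_image (f := fun t : ℝ ↦ Complex.exp (t * Complex.I)) ?_ ?_
  · refine (p.rootSet_finite ℂ).subset ?_
    rintro _ ⟨t, ht, rfl⟩
    simp only [mem_ofPred_eq, Classical.not_imp, not_not] at ht
    simp [Polynomial.mem_rootSet, hp, ht.2]
  · intro s hs t ht hst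
    simp only [mem_ofPred_eq, Classical.not_imp, not_not] at hs ht
    have h1 := congrArg Complex.arg hst
    simp only [Complex.exp_mul_I] at h1
    rwa [Complex.arg_cos_add_sin_mul_I hs.1, Complex.arg_cos_add_sin_mul_I ht.1] at h1

/-- A function whose absolute value on the circle is that of a nonzero polynomial vanishes almost
nowhere and has an integrable logarithm. -/
lemma ae_ne_zero_and_integrable_log_abs {f : ℝ → ℝ} {p : Polynomial ℂ} (hp : p ≠ 0)
    (h : ∀ t : ℝ, ‖p.eval (Complex.exp (t * Complex.I))‖ = |f t|) :
    (∀ᵐ t ∂angleMeasure, f t ≠ 0) ∧ Integrable (fun t ↦ Real.log |f t|) angleMeasure := by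
  constructor
  · filter_upwards [ae_eval_exp_ne_zero hp] with t ht
    rw [← abs_pos, ← h]; positivity
  · simpa only [h] using p.integrable_log_norm_eval_exp

lemma norm_eval_eq_abs_of_eq_exp_mul {p : Polynomial ℂ} {t r : ℝ} (n : ℕ)
    (h : p.eval (Complex.exp (t * Complex.I)) = Complex.exp (t * Complex.I) ^ n * r) :
    ‖p.eval (Complex.exp (t * Complex.I))‖ = |r| := by
  rw [h, norm_mul, norm_pow, Complex.norm_exp_ofReal_mul_I, one_pow, one_mul, Complex.norm_real,
    Real.norm_eq_abs]

lemma ofReal_cos_eq (t : ℝ) : ((cos t : ℝ) : ℂ)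
    = (Complex.exp (t * Complex.I) + (Complex.exp (t * Complex.I))⁻¹) / 2 := by
  rw [Complex.ofReal_cos, Complex.cos, neg_mul, Complex.exp_neg]

open Polynomial in
lemma norm_eval_X_sq_add_one (t : ℝ) :
    ‖(X ^ 2 + 1 : ℂ[X]).eval (Complex.exp (t * Complex.I))‖ = |2 * cos t| := by
  have hu : Complex.exp (t * Complex.I) ≠ 0 := Complex.exp_ne_zero _
  apply norm_eval_eq_abs_of_eq_exp_mul 1
  push_cast [ofReal_cos_eq, -Complex.ofReal_cos]
  simp only [eval_add, eval_pow, eval_X, eval_one]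
  field_simp

open Polynomial in
lemma cos_ae_ne_zero_and_integrable :
    (∀ᵐ t ∂angleMeasure, 2 * cos t ≠ 0) ∧
    Integrable (fun t ↦ Real.log |2 * cos t|) angleMeasure := by
  refine ae_ne_zero_and_integrable_log_abs (p := X ^ 2 + 1) ?_ norm_eval_X_sq_add_one
  exact Monic.ne_zero (by monicity!)

open Polynomial in
lemma cos_three_mul_ae_ne_zero_and_integrable :
    (∀ᵐ t ∂angleMeasure, 2 * cos (3 * t) ≠ 0) ∧
    Integrable (fun t ↦ Real.log |2 * cos (3 * t)|) angleMeasure := by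
  refine ae_ne_zero_and_integrable_log_abs (p := X ^ 6 + 1) ?_ fun t ↦ ?_
  · exact Monic.ne_zero (by monicity!)
  · have hu : Complex.exp (t * Complex.I) ≠ 0 := Complex.exp_ne_zero _
    apply norm_eval_eq_abs_of_eq_exp_mul 3
    rw [cos_three_mul]
    push_cast [ofReal_cos_eq, -Complex.ofReal_cos]
    simp only [eval_add, eval_pow, eval_X, eval_one]
    field_simp
    ring

open Polynomial in
lemma four_cos_sq_sub_one_ae_ne_zero_and_integrable :
    (∀ᵐ t ∂angleMeasure, 4 * cos t ^ 2 - 1 ≠ 0) ∧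
    Integrable (fun t ↦ Real.log |4 * cos t ^ 2 - 1|) angleMeasure := by
  refine ae_ne_zero_and_integrable_log_abs (p := X ^ 4 + X ^ 2 + 1) ?_ fun t ↦ ?_
  · exact Monic.ne_zero (by monicity!)
  · have hu : Complex.exp (t * Complex.I) ≠ 0 := Complex.exp_ne_zero _
    apply norm_eval_eq_abs_of_eq_exp_mul 2
    push_cast [ofReal_cos_eq, -Complex.ofReal_cos]
    simp only [eval_add, eval_pow, eval_X, eval_one]
    field_simp
    ring

lemma integral_log_abs_two_mul_cos :
    ∫ t, Real.log |2 * cos t| ∂angleMeasure = 0 := by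
  have h : (Polynomial.X ^ 2 + 1 : Polynomial ℂ) = Polynomial.realQuadratic 1 0 1 := by
    simp [Polynomial.realQuadratic]
  have h2 := (Polynomial.X ^ 2 + 1 : Polynomial ℂ).integral_log_norm_eval_exp
  simp only [norm_eval_X_sq_add_one] at h2
  rw [h2, h, Polynomial.logMahlerMeasure_realQuadratic_of_abs_le one_ne_zero (by simp)]
  simp

/-! ### Reduction to single integrals -/

/-- The fibrewise Mahler measure of `polyP k` for `k > 0`. -/
noncomputable def fiberP (k t : ℝ) : ℝ :=
  Real.log (max (k * |cos t|) |4 * cos t ^ 2 - 1|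
    + √(max (k * |cos t|) |4 * cos t ^ 2 - 1| ^ 2 - (4 * cos t ^ 2 - 1) ^ 2))

/-- The fibrewise Mahler measure of `polyR k` for `k ≥ 16 / (3 √3)`. -/
noncomputable def fiberR (k t : ℝ) : ℝ :=
  Real.log ((k + √(k ^ 2 + 16 * (cos t * cos (3 * t)))) / 2)

/-- The `max` in `fiberP` merges two regimes: roots on the unit circle, where the square root
vanishes, and real reciprocal roots. -/
lemma logMahlerMeasure_eq_fiberP {k t : ℝ} (ht : 4 * cos t ^ 2 - 1 ≠ 0) :
    (Polynomial.realQuadratic (4 * cos t ^ 2 - 1) (2 * k * cos t)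
      (4 * cos t ^ 2 - 1)).logMahlerMeasure = fiberP |k| t := by
  unfold fiberP
  generalize 4 * cos t ^ 2 - 1 = b at *
  have hB : |2 * k * cos t| = 2 * (|k| * |cos t|) := by
    rw [abs_mul, abs_mul, abs_two]; ring
  rcases le_total (|k| * |cos t|) |b| with h | h
  · rw [Polynomial.logMahlerMeasure_realQuadratic_of_abs_le ht (by rw [hB]; linarith),
      max_eq_right h, sq_abs, sub_self, sqrt_zero, add_zero]
  · rw [Polynomial.logMahlerMeasure_realQuadratic_of_abs_add_le ht
      (by rw [hB, ← two_mul, abs_mul, abs_two]; linarith), max_eq_left h, hB]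
    congr 1
    have e : (2 * k * cos t) ^ 2 - 4 * b * b = 2 ^ 2 * ((|k| * |cos t|) ^ 2 - b ^ 2) := by
      rw [mul_pow |k|, sq_abs, sq_abs]; ring
    rw [e, sqrt_mul (by norm_num), sqrt_sq (by norm_num)]
    ring

lemma abs_cos_three_mul_sub_cos_le (t : ℝ) :
    |2 * cos (3 * t) + -(2 * cos t)| ≤ 16 / (3 * √3) := by
  refine abs_le_of_sq_le_sq ?_ (by positivity)
  rw [div_pow, mul_pow, sq_sqrt (by norm_num), cos_three_mul]
  have h0 := sq_nonneg (cos t)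
  have h1 := cos_sq_le_one t
  -- With `s = cos² t` the squared bound reads `27 s (1 - s)² ≤ 4`; the deficit is this product,
  -- which vanishes at the maximum `s = 1/3`.
  have : 0 ≤ (3 * cos t ^ 2 - 1) ^ 2 * (4 - 3 * cos t ^ 2) :=
    mul_nonneg (sq_nonneg _) (by linarith)
  nlinarith

lemma logMahlerMeasure_eq_fiberR {k t : ℝ} (hk : 16 / (3 * √3) ≤ |k|)
    (ht : 2 * cos (3 * t) ≠ 0) :
    (Polynomial.realQuadratic (2 * cos (3 * t)) k (-(2 * cos t))).logMahlerMeasure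
      = fiberR |k| t := by
  rw [Polynomial.logMahlerMeasure_realQuadratic_of_abs_add_le ht
    ((abs_cos_three_mul_sub_cos_le t).trans hk), fiberR, sq_abs]
  congr 4
  ring

lemma polyP_mahler (k : ℝ) :
    IntegrableOn (logNormOnTorus (polyP k)) torusAngles ∧
    logMahlerMeasure₂ (polyP k) = 1 / (2 * π) * ∫ t, fiberP |k| t ∂angleMeasure ∧
    Integrable (fiberP |k|) angleMeasure := by
  obtain ⟨h0, hi⟩ := four_cos_sq_sub_one_ae_ne_zero_and_integrable
  have hI := integrable_logNormQuadratic (A := fun t ↦ 4 * cos t ^ 2 - 1)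
    (B := fun t ↦ 2 * k * cos t) (D := fun t ↦ 4 * cos t ^ 2 - 1)
    (by fun_prop) (by fun_prop) (by fun_prop) h0 hi
  obtain ⟨e1, e2⟩ := torus_double_add (polyP k)
  obtain ⟨e3, e4⟩ := integral_logNormQuadratic (A := fun t ↦ 4 * cos t ^ 2 - 1)
    (B := fun t ↦ 2 * k * cos t) (D := fun t ↦ 4 * cos t ^ 2 - 1) hI
  have hae : (fun t ↦ (Polynomial.realQuadratic (4 * cos t ^ 2 - 1) (2 * k * cos t)
      (4 * cos t ^ 2 - 1)).logMahlerMeasure) =ᵐ[angleMeasure] fiberP |k| := by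
    filter_upwards [h0] with t ht using logMahlerMeasure_eq_fiberP ht
  simp only [logNormOnTorus_polyP] at e1 e2
  refine ⟨e1.mpr hI, ?_, e4.congr hae⟩
  rw [logMahlerMeasure₂, e2, e3, integral_congr_ae hae, ← mul_assoc]
  congr 1
  field_simp

lemma polyR_mahler {k : ℝ} (hk : 16 / (3 * √3) ≤ |k|) :
    IntegrableOn (logNormOnTorus (polyR k)) torusAngles ∧
    logMahlerMeasure₂ (polyR k) = 1 / (2 * π) * ∫ t, fiberR |k| t ∂angleMeasure ∧
    Integrable (fiberR |k|) angleMeasure := by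
  obtain ⟨h0, hi⟩ := cos_three_mul_ae_ne_zero_and_integrable
  have hI := integrable_logNormQuadratic (A := fun t ↦ 2 * cos (3 * t))
    (B := fun _ ↦ k) (D := fun t ↦ -(2 * cos t))
    (by fun_prop) (by fun_prop) (by fun_prop) h0 hi
  obtain ⟨e1, e2⟩ := torus_add_sub (polyR k)
  obtain ⟨e3, e4⟩ := integral_logNormQuadratic (A := fun t ↦ 2 * cos (3 * t))
    (B := fun _ ↦ k) (D := fun t ↦ -(2 * cos t)) hI
  have hae : (fun t ↦ (Polynomial.realQuadratic (2 * cos (3 * t)) k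
      (-(2 * cos t))).logMahlerMeasure) =ᵐ[angleMeasure] fiberR |k| := by
    filter_upwards [h0] with t ht using logMahlerMeasure_eq_fiberR hk ht
  simp only [logNormOnTorus_polyR] at e1 e2
  refine ⟨e1.mpr hI, ?_, e4.congr hae⟩
  rw [logMahlerMeasure₂, e2, e3, integral_congr_ae hae, ← mul_assoc]
  congr 1
  field_simp

/-! ### Differentiation in the parameter -/

lemma lintegral_ofReal_deriv {g g' : ℝ → ℝ} {a b : ℝ} (hab : a ≤ b)
    (hcont : ContinuousOn g (Icc a b)) (hderiv : ∀ x ∈ Ioo a b, HasDerivAt g (g' x) x)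
    (hpos : ∀ x, 0 ≤ g' x) :
    ∫⁻ x in Ioc a b, ENNReal.ofReal (g' x) = ENNReal.ofReal (g b - g a) := by
  have hi := intervalIntegral.integrableOn_deriv_of_nonneg hcont hderiv fun x _ ↦ hpos x
  rw [← ofReal_integral_eq_lintegral_ofReal hi (Eventually.of_forall hpos),
    ← intervalIntegral.integral_of_le hab,
    intervalIntegral.integral_eq_sub_of_hasDerivAt_of_le hab hcont hderiv
      ((intervalIntegrable_iff_integrableOn_Ioc_of_le hab).mpr hi)]

lemma fiberR_discr_pos {k : ℝ} (hk : 3 < k) (t : ℝ) :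
    0 < k ^ 2 + 16 * (cos t * cos (3 * t)) := by
  rw [cos_three_mul]
  nlinarith [sq_nonneg (8 * cos t ^ 2 - 3)]

lemma hasDerivAt_fiberR {k : ℝ} (hk : 3 < k) (t : ℝ) :
    HasDerivAt (fun x ↦ fiberR x t) (1 / √(k ^ 2 + 16 * (cos t * cos (3 * t)))) k := by
  have hp := fiberR_discr_pos hk t
  unfold fiberR
  have hs := sqrt_pos.mpr hp
  have h1 : HasDerivAt (fun x : ℝ ↦ x ^ 2 + 16 * (cos t * cos (3 * t))) (2 * k) k := by
    simpa using (hasDerivAt_pow 2 k).add_const (16 * (cos t * cos (3 * t)))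
  have h2 := (((hasDerivAt_id k).add (h1.sqrt hp.ne')).div_const 2).log
    (by simp only [Pi.add_apply, id]; positivity)
  refine h2.congr_deriv ?_
  simp only [Pi.add_apply, id]
  generalize √(k ^ 2 + 16 * (cos t * cos (3 * t))) = S at hs
  field_simp
  ring

lemma lintegral_deriv_fiberR {k K : ℝ} (hk : 3 < k) (hK : k ≤ K) (t : ℝ) :
    ∫⁻ x in Ioc k K, ENNReal.ofReal (1 / √(x ^ 2 + 16 * (cos t * cos (3 * t))))
      = ENNReal.ofReal (fiberR K t - fiberR k t) :=
  lintegral_ofReal_deriv hK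
    (fun x hx ↦ (hasDerivAt_fiberR (hk.trans_le hx.1) t).continuousAt.continuousWithinAt)
    (fun _ hx ↦ hasDerivAt_fiberR (hk.trans hx.1) t) fun _ ↦ by positivity

lemma hasDerivAt_log_add_sqrt {b c x : ℝ} (hb : 0 < b) (hc : 0 < c) (hx : b < x * c) :
    HasDerivAt (fun x ↦ Real.log (max (x * c) b + √(max (x * c) b ^ 2 - b ^ 2)))
      (c / √((x * c) ^ 2 - b ^ 2)) x := by
  have hp : 0 < (x * c) ^ 2 - b ^ 2 := by nlinarith
  have hs := sqrt_pos.mpr hp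
  have hxc : 0 < x * c := hb.trans hx
  have h0 : HasDerivAt (fun x : ℝ ↦ x * c) c x := by simpa using (hasDerivAt_id x).mul_const c
  have h1 : HasDerivAt (fun x : ℝ ↦ (x * c) ^ 2 - b ^ 2) (2 * (x * c) * c) x := by
    simpa using (h0.pow 2).sub_const (b ^ 2)
  have h2 := (h0.add (h1.sqrt hp.ne')).log (by simp only [Pi.add_apply]; positivity)
  have h3 := h2.congr_deriv (g' := c / √((x * c) ^ 2 - b ^ 2)) (by
    simp only [Pi.add_apply]
    generalize √((x * c) ^ 2 - b ^ 2) = S at hs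
    rw [div_eq_div_iff (by positivity) hs.ne']
    field_simp
    ring)
  refine h3.congr_of_eventuallyEq ?_
  have : ∀ᶠ y in 𝓝 x, b < y * c := h0.continuousAt.eventually (lt_mem_nhds hx)
  filter_upwards [this] with y hy
  simp [max_eq_left hy.le]

lemma lintegral_deriv_log_add_sqrt {b c k K : ℝ} (hb : 0 < b) (hc : 0 < c) (hk : 0 ≤ k)
    (hK : k ≤ K) :
    ∫⁻ x in Ioc k K, ENNReal.ofReal (c / √((x * c) ^ 2 - b ^ 2))
      = ENNReal.ofReal (Real.log (max (K * c) b + √(max (K * c) b ^ 2 - b ^ 2))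
        - Real.log (max (k * c) b + √(max (k * c) b ^ 2 - b ^ 2))) := by
  set g : ℝ → ℝ := fun x ↦ Real.log (max (x * c) b + √(max (x * c) b ^ 2 - b ^ 2)) with hg
  have hcont : Continuous g := by
    refine Continuous.log (by fun_prop) fun x ↦ ?_
    have : 0 < max (x * c) b := lt_max_of_lt_right hb
    positivity
  change _ = ENNReal.ofReal (g K - g k)
  -- The corner of `g` at `b / c`, clamped to `[k, K]`: `g` is constant before it and follows an
  -- inverse hyperbolic cosine after it.
  set m := min (max k (b / c)) K with hm
  have hkm : k ≤ m := le_min (le_max_left _ _) hK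
  have hmK : m ≤ K := min_le_right _ _
  rw [← Ioc_union_Ioc_eq_Ioc hkm hmK, lintegral_union measurableSet_Ioc
    (Ioc_disjoint_Ioc_of_le le_rfl)]
  have e1 : ∫⁻ x in Ioc k m, ENNReal.ofReal (c / √((x * c) ^ 2 - b ^ 2)) = 0 := by
    rw [setLIntegral_congr_fun (g := fun _ ↦ 0) measurableSet_Ioc, lintegral_zero]
    intro x hx
    have h1 : x ≤ b / c := by
      rcases le_max_iff.mp (hx.2.trans (min_le_left _ _)) with h | h
      · exact absurd hx.1 (not_lt.mpr h)
      · exact h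
    rw [le_div_iff₀ hc] at h1
    have hx0 : 0 ≤ x := hk.trans hx.1.le
    -- The real square root of a nonpositive number is `0` and so is division by `0`, so the
    -- integrand vanishes where `g` is constant.
    have : (x * c) ^ 2 - b ^ 2 ≤ 0 := sub_nonpos.mpr (pow_le_pow_left₀ (by positivity) h1 2)
    simp [sqrt_eq_zero_of_nonpos this]
  have e2 : g m = g k := by
    rcases le_total (b / c) k with h | h
    · rw [hm, max_eq_left h, min_eq_left hK]
    · have h1 : m * c ≤ b := (le_div_iff₀ hc).mp ((min_le_left _ _).trans (max_eq_right h).le)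
      have h2 : k * c ≤ b := (le_div_iff₀ hc).mp h
      simp only [hg, max_eq_right h1, max_eq_right h2]
  have e3 : ∫⁻ x in Ioc m K, ENNReal.ofReal (c / √((x * c) ^ 2 - b ^ 2))
      = ENNReal.ofReal (g K - g m) := by
    refine lintegral_ofReal_deriv hmK hcont.continuousOn (fun x hx ↦ ?_) fun x ↦ by positivity
    refine hasDerivAt_log_add_sqrt hb hc ?_
    rw [← div_lt_iff₀ hc]
    rcases min_lt_iff.mp hx.1 with h | h
    · exact (le_max_right _ _).trans_lt h
    · exact absurd hx.2 (not_lt.mpr h.le)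
  rw [e1, e3, e2, zero_add]

lemma lintegral_deriv_fiberP {k K t : ℝ} (hk : 0 ≤ k) (hK : k ≤ K) (hc : cos t ≠ 0)
    (hb : 4 * cos t ^ 2 - 1 ≠ 0) :
    ∫⁻ x in Ioc k K, ENNReal.ofReal (|cos t| / √((x * |cos t|) ^ 2 - (4 * cos t ^ 2 - 1) ^ 2))
      = ENNReal.ofReal (fiberP K t - fiberP k t) := by
  have h := lintegral_deriv_log_add_sqrt (abs_pos.mpr hb) (abs_pos.mpr hc) hk hK
  simpa only [fiberP, sq_abs (4 * cos t ^ 2 - 1)] using h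

/-! ### The substitution `s = cos² t` -/

lemma measurePreserving_add_self :
    MeasurePreserving (fun a : AddCircle (2 * π) ↦ a + a) volume volume := by
  refine AddMonoidHom.measurePreserving
    (f := AddMonoidHom.id (AddCircle (2 * π)) + AddMonoidHom.id (AddCircle (2 * π))) ?_ ?_ rfl
  · change Continuous fun a : AddCircle (2 * π) ↦ a + a
    fun_prop
  · exact fun p ↦ exists_two_nsmul_addCircle p

/-- Doubling preserves Haar measure on the circle. It lets `cos² t = (1 + cos 2t) / 2` be replaced
by `(1 + cos t) / 2`, which is injective on each half period. -/
lemma lintegral_comp_cos_double {G : ℝ → ENNReal} (hG : Measurable G) :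
    ∫⁻ t, G (cos (t + t)) ∂angleMeasure = ∫⁻ t, G (cos t) ∂angleMeasure := by
  set H : AddCircle (2 * π) → ENNReal := fun a ↦ G ((AddCircle.toCircle a : ℂ).re)
  have hH : Measurable H := hG.comp (Continuous.measurable
    (Complex.continuous_re.comp (continuous_subtype_val.comp AddCircle.continuous_toCircle)))
  have e : ∀ t : ℝ, G (cos t) = H t := fun t ↦ by
    simp only [H, toCircle_coe_two_pi, Complex.exp_ofReal_mul_I_re]
  have hT := measurePreserving_coe_addCircle
  simp only [e, AddCircle.coe_add]
  rw [hT.lintegral_comp hH, ← measurePreserving_add_self.lintegral_comp hH]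
  exact hT.lintegral_comp (f := fun a ↦ H (a + a))
    (hH.comp measurePreserving_add_self.measurable)

lemma lintegral_comp_one_add_cos_div_two {s : Set ℝ} (hs : MeasurableSet s)
    (hinj : InjOn cos s) (himg : cos '' s = Ioo (-1) 1) (G : ℝ → ENNReal) :
    ∫⁻ t in s, G ((1 + cos t) / 2)
      = ∫⁻ x in Ioo 0 1, ENNReal.ofReal (1 / √(x * (1 - x))) * G x := by
  have hi : (fun t ↦ (1 + cos t) / 2) '' s = Ioo 0 1 := by
    rw [← image_image (fun x ↦ (1 + x) / 2) cos, himg]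
    ext y
    simp only [mem_image, mem_Ioo]
    exact ⟨fun ⟨x, hx, e⟩ ↦ ⟨by linarith, by linarith⟩,
      fun hy ↦ ⟨2 * y - 1, ⟨by linarith, by linarith⟩, by ring⟩⟩
  have hd : ∀ t ∈ s, HasDerivWithinAt (fun t ↦ (1 + cos t) / 2) (-sin t / 2) s t := fun t _ ↦
    (((hasDerivAt_cos t).const_add 1).div_const 2).hasDerivWithinAt
  rw [← hi, lintegral_image_eq_lintegral_abs_deriv_mul hs hd
    (fun x hx y hy h ↦ hinj hx hy (by linarith))]
  refine setLIntegral_congr_fun hs fun t ht ↦ ?_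
  have hm : cos t ∈ Ioo (-1 : ℝ) 1 := himg ▸ mem_image_of_mem _ ht
  have hsin : 0 < sin t ^ 2 := by nlinarith [sin_sq_add_cos_sq t, hm.1, hm.2]
  have hne : 0 < |sin t| := abs_pos.mpr (pow_ne_zero_iff two_ne_zero |>.mp hsin.ne')
  have e : (1 + cos t) / 2 * (1 - (1 + cos t) / 2) = (sin t / 2) ^ 2 := by
    nlinarith [sin_sq_add_cos_sq t]
  rw [e, sqrt_sq_eq_abs, ← mul_assoc, ← ENNReal.ofReal_mul (abs_nonneg _), abs_div, abs_div,
    abs_neg, abs_two, mul_one_div_cancel (by positivity), ENNReal.ofReal_one, one_mul]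

lemma image_cos_Ioo_zero_pi : cos '' Ioo 0 π = Ioo (-1) 1 := by
  ext y
  constructor
  · rintro ⟨t, ht, rfl⟩
    have h1 := strictAntiOn_cos (left_mem_Icc.mpr pi_pos.le) (Ioo_subset_Icc_self ht) ht.1
    have h2 := strictAntiOn_cos (Ioo_subset_Icc_self ht) (right_mem_Icc.mpr pi_pos.le) ht.2
    simp only [cos_zero, cos_pi] at h1 h2
    exact ⟨h2, h1⟩
  · intro hy
    exact ⟨arccos y, ⟨arccos_pos.mpr hy.2, (arccos_lt_pi).mpr hy.1⟩, cos_arccos hy.1.le hy.2.le⟩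

lemma lintegral_comp_cos_sq {G : ℝ → ENNReal} (hG : Measurable G) :
    ∫⁻ t, G (cos t ^ 2) ∂angleMeasure
      = 2 * ∫⁻ x in Ioo 0 1, ENNReal.ofReal (1 / √(x * (1 - x))) * G x := by
  have e : ∀ t, G (cos t ^ 2) = (fun x ↦ G ((1 + x) / 2)) (cos (t + t)) := fun t ↦ by
    simp only [← two_mul, cos_two_mul]; congr 1; ring
  have h1 := lintegral_comp_one_add_cos_div_two measurableSet_Ioo
    (strictAntiOn_cos.injOn.mono Ioo_subset_Icc_self) image_cos_Ioo_zero_pi G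
  have hneg : Ioo (-π) 0 = Neg.neg '' Ioo 0 π := by simp
  have h2 := lintegral_comp_one_add_cos_div_two (s := Ioo (-π) 0) measurableSet_Ioo
    (by
      intro x hx y hy h
      rw [← cos_neg x, ← cos_neg y] at h
      have := strictAntiOn_cos.injOn ⟨by linarith [hx.2], by linarith [hx.1]⟩
        ⟨by linarith [hy.2], by linarith [hy.1]⟩ h
      linarith)
    (by rw [hneg, image_image]; simp only [cos_neg]; exact image_cos_Ioo_zero_pi) G
  rw [lintegral_congr e, lintegral_comp_cos_double (G := fun x ↦ G ((1 + x) / 2))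
    (hG.comp (by fun_prop)), angleMeasure,
    ← Ioc_union_Ioc_eq_Ioc (neg_nonpos.mpr pi_pos.le) pi_pos.le,
    lintegral_union measurableSet_Ioc (Ioc_disjoint_Ioc_of_le le_rfl),
    ← restrict_Ioo_eq_restrict_Ioc, ← restrict_Ioo_eq_restrict_Ioc]
  rw [h1, h2, two_mul]

/-! ### The two-isogeny between the elliptic integrals -/

/-- The change of variable relating the two elliptic integrals, a two-isogeny in the
coordinate `s = cos² τ`. -/
noncomputable def isogenyMap (k s : ℝ) : ℝ :=
  1 - 4 * (k ^ 2 - 9) * (s * (1 - s)) / (k ^ 2 - 48 * s + 64 * s ^ 2)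

section Isogeny

variable {k : ℝ}

lemma isogeny_denom_pos (hk : 3 < k) (s : ℝ) : 0 < k ^ 2 - 48 * s + 64 * s ^ 2 := by
  nlinarith [sq_nonneg (8 * s - 3)]

lemma one_sub_isogenyMap (k s : ℝ) :
    1 - isogenyMap k s = 4 * (k ^ 2 - 9) * (s * (1 - s)) / (k ^ 2 - 48 * s + 64 * s ^ 2) := by
  rw [isogenyMap]; ring

/-- The right side is a constant times a square, and the squared factor `k² - 2k²s - 16s²` is also
the one in the derivative of `isogenyMap`. It therefore cancels when the differential is pulled
back. -/
lemma isogenyMap_quadratic (hk : 3 < k) (s : ℝ) :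
    k ^ 2 * isogenyMap k s - (4 * isogenyMap k s - 1) ^ 2
      = (k ^ 2 - 9) * (k ^ 2 - 2 * k ^ 2 * s - 16 * s ^ 2) ^ 2
        / (k ^ 2 - 48 * s + 64 * s ^ 2) ^ 2 := by
  have hq := (isogeny_denom_pos hk s).ne'
  rw [isogenyMap]
  generalize hr : k ^ 2 - 48 * s + 64 * s ^ 2 = q at hq ⊢
  rw [show k ^ 2 = q + 48 * s - 64 * s ^ 2 by rw [← hr]; ring]
  field_simp
  ring

lemma hasDerivAt_isogenyMap (hk : 3 < k) (s : ℝ) :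
    HasDerivAt (isogenyMap k) (-(4 * (k ^ 2 - 9) * (k ^ 2 - 2 * k ^ 2 * s - 16 * s ^ 2)
      / (k ^ 2 - 48 * s + 64 * s ^ 2) ^ 2)) s := by
  have hq := (isogeny_denom_pos hk s).ne'
  have h1 : HasDerivAt (fun s : ℝ ↦ 4 * (k ^ 2 - 9) * (s * (1 - s)))
      (4 * (k ^ 2 - 9) * (1 * (1 - s) + s * (-1))) s :=
    ((hasDerivAt_id s).mul ((hasDerivAt_id s).const_sub 1)).const_mul _
  have h2 : HasDerivAt (fun s : ℝ ↦ k ^ 2 - 48 * s + 64 * s ^ 2)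
      (-(48 * 1) + 64 * (2 * s)) s := by
    have := (((hasDerivAt_id s).const_mul 48).const_sub (k ^ 2)).add
      ((hasDerivAt_pow 2 s).const_mul 64)
    simpa using! this
  refine ((h1.div h2 hq).const_sub 1).congr_deriv ?_
  field_simp
  ring

/-- Distinct points with equal image are exchanged by the deck involution `k²(1 - x - y) = 16xy`, so
injectivity holds on any set that contains no such pair. -/
lemma injOn_isogenyMap (hk : 3 < k) {I : Set ℝ}
    (hI : ∀ x ∈ I, ∀ y ∈ I, k ^ 2 * (1 - x - y) - 16 * x * y ≠ 0) :
    InjOn (isogenyMap k) I := by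
  intro x hx y hy h
  have hqx := (isogeny_denom_pos hk x).ne'
  have hqy := (isogeny_denom_pos hk y).ne'
  have hk9 : k ^ 2 - 9 ≠ 0 := by nlinarith
  have h1 : 1 - isogenyMap k x = 1 - isogenyMap k y := by rw [h]
  rw [one_sub_isogenyMap, one_sub_isogenyMap, div_eq_div_iff hqx hqy] at h1
  have h2 : 4 * (k ^ 2 - 9) * ((x - y) * (k ^ 2 * (1 - x - y) - 16 * x * y)) = 0 := by
    linear_combination h1
  have h3 := (mul_eq_zero.mp h2).resolve_left (by positivity)
  exact sub_eq_zero.mp ((mul_eq_zero.mp h3).resolve_right (hI x hx y hy))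

/-- The integrand for `polyP` in the coordinate `s = cos² t`. -/
noncomputable def densityP (k s : ℝ) : ENNReal :=
  ENNReal.ofReal (1 / (√(1 - s) * √(k ^ 2 * s - (4 * s - 1) ^ 2)))

/-- The integrand for `polyR` in the coordinate `s = cos² t`. -/
noncomputable def densityR (k s : ℝ) : ENNReal :=
  ENNReal.ofReal (1 / (√(s * (1 - s)) * √(k ^ 2 - 48 * s + 64 * s ^ 2)))

lemma abs_deriv_mul_densityP (hk : 3 < k) {s : ℝ} (hs : s ∈ Ioo 0 1)
    (hN : k ^ 2 - 2 * k ^ 2 * s - 16 * s ^ 2 ≠ 0) :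
    ENNReal.ofReal |-(4 * (k ^ 2 - 9) * (k ^ 2 - 2 * k ^ 2 * s - 16 * s ^ 2)
      / (k ^ 2 - 48 * s + 64 * s ^ 2) ^ 2)| * densityP k (isogenyMap k s) = 2 * densityR k s := by
  have hq := isogeny_denom_pos hk s
  have hk9 : 0 < k ^ 2 - 9 := by nlinarith
  have hss : 0 < s * (1 - s) := mul_pos hs.1 (by linarith [hs.2])
  rw [densityP, densityR, isogenyMap_quadratic hk, one_sub_isogenyMap,
    ← ENNReal.ofReal_mul (abs_nonneg _), ← ENNReal.ofReal_ofNat 2, ← ENNReal.ofReal_mul (by norm_num)]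
  congr 1
  set q := k ^ 2 - 48 * s + 64 * s ^ 2
  set N := k ^ 2 - 2 * k ^ 2 * s - 16 * s ^ 2
  set d := k ^ 2 - 9
  set w := s * (1 - s)
  have hNp : 0 < |N| := abs_pos.mpr hN
  rw [sqrt_div (by positivity), sqrt_div (by positivity), sqrt_mul hk9.le, sqrt_sq_eq_abs,
    sqrt_sq hq.le, sqrt_mul (by positivity), sqrt_mul (by norm_num),
    show √4 = 2 by rw [show (4 : ℝ) = 2 ^ 2 by norm_num]; exact sqrt_sq (by norm_num),
    abs_neg, abs_div, abs_mul, abs_of_pos (show 0 < 4 * d by positivity),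
    abs_of_pos (show 0 < q ^ 2 by positivity)]
  have h1 := sqrt_pos.mpr hq
  have h2 := sqrt_pos.mpr hk9
  have h3 := sqrt_pos.mpr hss
  have e1 := sq_sqrt hq.le
  have e2 := sq_sqrt hk9.le
  field_simp
  rw [e1, e2]
  ring

/-- The point `m` is the critical point, fixed by the deck involution. The map goes from `1` at the
endpoint `e` to the smaller root of `k²y = (4y - 1)²` at `m`, and this root bounds the support of
`densityP` from below. Either choice of `e` gives the same image. -/
lemma image_isogenyMap (hk : 3 < k) {m e : ℝ} (hm : m ∈ Ioo 0 1)
    (hN : k ^ 2 - 2 * k ^ 2 * m - 16 * m ^ 2 = 0) (he : e = 0 ∨ e = 1) :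
    isogenyMap k '' (uIoo e m) = {y | y ∈ Ioo 0 1 ∧ (4 * y - 1) ^ 2 < k ^ 2 * y} := by
  have hk9 : 0 < k ^ 2 - 9 := by nlinarith
  have hfe : isogenyMap k e = 1 := by
    rcases he with rfl | rfl <;> simp [isogenyMap]
  have hcont : Continuous (isogenyMap k) :=
    continuous_iff_continuousAt.mpr fun s ↦ (hasDerivAt_isogenyMap hk s).continuousAt
  ext y
  constructor
  · rintro ⟨s, hs, rfl⟩
    have hs01 : s ∈ Ioo 0 1 ∧ s ≠ m := by
      rcases he with rfl | rfl
      · rw [uIoo_of_le hm.1.le] at hs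
        exact ⟨⟨hs.1, hs.2.trans hm.2⟩, hs.2.ne⟩
      · rw [uIoo_of_ge hm.2.le] at hs
        exact ⟨⟨hm.1.trans hs.1, hs.2⟩, hs.1.ne'⟩
    obtain ⟨⟨h0, h1⟩, hne⟩ := hs01
    have hq := isogeny_denom_pos hk s
    have hNs : k ^ 2 - 2 * k ^ 2 * s - 16 * s ^ 2 ≠ 0 := by
      have e : k ^ 2 - 2 * k ^ 2 * s - 16 * s ^ 2 = (m - s) * (2 * k ^ 2 + 16 * (s + m)) := by
        linear_combination hN
      rw [e]
      have := hm.1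
      exact mul_ne_zero (sub_ne_zero.mpr hne.symm) (by positivity)
    have hlt : 0 < k ^ 2 * isogenyMap k s - (4 * isogenyMap k s - 1) ^ 2 := by
      rw [isogenyMap_quadratic hk]; positivity
    have h1' : 0 < 1 - isogenyMap k s := by
      rw [one_sub_isogenyMap]
      have : 0 < 1 - s := by linarith
      positivity
    refine ⟨⟨?_, by linarith⟩, by linarith⟩
    have : 0 < k ^ 2 * isogenyMap k s := by nlinarith [sq_nonneg (4 * isogenyMap k s - 1)]
    exact pos_of_mul_pos_right this (by positivity)
  · rintro ⟨⟨h0, h1⟩, hy⟩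
    have hzero := isogenyMap_quadratic hk m
    rw [hN] at hzero
    have hfm1 : isogenyMap k m < 1 := by
      have : 0 < 1 - isogenyMap k m := by
        rw [one_sub_isogenyMap]
        have := isogeny_denom_pos hk m
        have h1 := hm.1
        have h2 : 0 < 1 - m := by linarith [hm.2]
        positivity
      linarith
    have hlt : isogenyMap k m < y := by
      by_contra! hle
      generalize isogenyMap k m = z at *
      have hz : k ^ 2 * z = (4 * z - 1) ^ 2 := by
        have : k ^ 2 * z - (4 * z - 1) ^ 2 = 0 := by rw [hzero]; simp
        linarith
      -- concavity of `k² z - (4 z - 1)²` between `y` and `1`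
      have key : (1 - y) * (k ^ 2 * z - (4 * z - 1) ^ 2)
          = (1 - z) * (k ^ 2 * y - (4 * y - 1) ^ 2) + (z - y) * (k ^ 2 - 9)
            + 16 * (1 - z) * (z - y) * (1 - y) := by ring
      have t1 : 0 < (1 - z) * (k ^ 2 * y - (4 * y - 1) ^ 2) :=
        mul_pos (by linarith) (by linarith)
      have t2 : 0 ≤ (z - y) * (k ^ 2 - 9) := mul_nonneg (by linarith) hk9.le
      have t3 : 0 ≤ 16 * (1 - z) * (z - y) * (1 - y) :=
        mul_nonneg (mul_nonneg (by linarith) (by linarith)) (by linarith)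
      rw [hz, sub_self, mul_zero] at key
      linarith
    have hmem : y ∈ uIcc (isogenyMap k e) (isogenyMap k m) := by
      rw [hfe, uIcc_of_ge hfm1.le]; exact ⟨hlt.le, h1.le⟩
    obtain ⟨s, hs, rfl⟩ := intermediate_value_uIcc hcont.continuousOn hmem
    refine ⟨s, ?_, rfl⟩
    have hse : s ≠ e := by rintro rfl; linarith
    have hsm : s ≠ m := by rintro rfl; linarith
    rcases he with rfl | rfl
    · rw [uIcc_of_le hm.1.le] at hs
      rw [uIoo_of_le hm.1.le]
      exact ⟨lt_of_le_of_ne hs.1 hse.symm, lt_of_le_of_ne hs.2 hsm⟩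
    · rw [uIcc_of_ge hm.2.le] at hs
      rw [uIoo_of_ge hm.2.le]
      exact ⟨lt_of_le_of_ne hs.1 hsm.symm, lt_of_le_of_ne hs.2 hse⟩

lemma lintegral_densityP_eq_uIoo (hk : 3 < k) {m e : ℝ} (hm : m ∈ Ioo 0 1)
    (hN : k ^ 2 - 2 * k ^ 2 * m - 16 * m ^ 2 = 0) (he : e = 0 ∨ e = 1) :
    ∫⁻ y in Ioo 0 1, densityP k y = ∫⁻ s in uIoo e m, 2 * densityR k s := by
  have hS : ∫⁻ y in Ioo 0 1, densityP k y
      = ∫⁻ y in {y | y ∈ Ioo 0 1 ∧ (4 * y - 1) ^ 2 < k ^ 2 * y}, densityP k y := by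
    have hB : MeasurableSet {y : ℝ | (4 * y - 1) ^ 2 < k ^ 2 * y} :=
      (isOpen_lt (by fun_prop) (by fun_prop)).measurableSet
    rw [← lintegral_inter_add_sdiff _ _ hB, setLIntegral_eq_zero (measurableSet_Ioo.diff hB),
      add_zero]
    · rfl
    · rintro y ⟨hy, hny⟩
      have : k ^ 2 * y - (4 * y - 1) ^ 2 ≤ 0 := by
        by_contra! h
        exact hny (by simpa using h)
      simp [densityP, sqrt_eq_zero_of_nonpos this]
  have hsub : ∀ s ∈ uIoo e m, s ∈ Ioo 0 1 := by
    intro s hs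
    rcases he with rfl | rfl
    · rw [uIoo_of_le hm.1.le] at hs
      exact ⟨hs.1, hs.2.trans hm.2⟩
    · rw [uIoo_of_ge hm.2.le] at hs
      exact ⟨hm.1.trans hs.1, hs.2⟩
  have hm0 := hm.1
  have hk2 : 0 < k ^ 2 := by positivity
  have hne : ∀ x ∈ uIoo e m, ∀ y ∈ uIoo e m, k ^ 2 * (1 - x - y) - 16 * x * y ≠ 0 := by
    intro x hx y hy
    have hx0 := (hsub x hx).1
    have hy0 := (hsub y hy).1
    -- Both summands have the same sign when `x` and `y` lie on the same side of `m`.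
    have e1 : k ^ 2 * (1 - x - y) - 16 * x * y
        = (m - x) * (k ^ 2 + 16 * y) + (m - y) * (k ^ 2 + 16 * m) := by
      linear_combination hN
    rw [e1]
    rcases he with rfl | rfl
    · rw [uIoo_of_le hm.1.le] at hx hy
      have h1 := sub_pos.mpr hx.2
      have h2 := sub_pos.mpr hy.2
      positivity
    · rw [uIoo_of_ge hm.2.le] at hx hy
      have h1 := sub_pos.mpr hx.1
      have h2 := sub_pos.mpr hy.1
      have : 0 < (x - m) * (k ^ 2 + 16 * y) + (y - m) * (k ^ 2 + 16 * m) := by positivity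
      exact ne_of_lt (by linarith)
  have hmeas : MeasurableSet (uIoo e m) := measurableSet_Ioo
  rw [hS, ← image_isogenyMap hk hm hN he, lintegral_image_eq_lintegral_abs_deriv_mul
    hmeas (fun s _ ↦ (hasDerivAt_isogenyMap hk s).hasDerivWithinAt)
    (injOn_isogenyMap hk hne)]
  refine setLIntegral_congr_fun hmeas fun s hs ↦ ?_
  refine abs_deriv_mul_densityP hk (hsub s hs) ?_
  have := hne s hs s hs
  contrapose! this
  linear_combination this

/-- Each branch contributes one copy of the left integral, so adding them gives twice the left equal
to twice the right. Cancelling the `2` is valid in `ENNReal` even without finiteness. -/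
lemma lintegral_densityP_eq_lintegral_densityR (hk : 3 < k) :
    ∫⁻ y in Ioo 0 1, densityP k y = ∫⁻ s in Ioo 0 1, densityR k s := by
  obtain ⟨m, hm, hN⟩ : ∃ m ∈ Ioo (0 : ℝ) 1, k ^ 2 - 2 * k ^ 2 * m - 16 * m ^ 2 = 0 := by
    have hc : ContinuousOn (fun m : ℝ ↦ k ^ 2 - 2 * k ^ 2 * m - 16 * m ^ 2) (Icc 0 1) := by
      fun_prop
    exact intermediate_value_Ioo' zero_le_one hc ⟨by nlinarith, by nlinarith⟩
  have h0 := lintegral_densityP_eq_uIoo hk hm hN (Or.inl rfl)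
  have h1 := lintegral_densityP_eq_uIoo hk hm hN (Or.inr rfl)
  rw [uIoo_of_le hm.1.le] at h0
  rw [uIoo_of_ge hm.2.le] at h1
  have hadd : ∫⁻ s in Ioo 0 1, 2 * densityR k s
      = (∫⁻ s in Ioo 0 m, 2 * densityR k s) + ∫⁻ s in Ioo m 1, 2 * densityR k s := by
    rw [restrict_Ioo_eq_restrict_Ioc, restrict_Ioo_eq_restrict_Ioc, restrict_Ioo_eq_restrict_Ioc,
      ← Ioc_union_Ioc_eq_Ioc hm.1.le hm.2.le,
      lintegral_union measurableSet_Ioc (Ioc_disjoint_Ioc_of_le le_rfl)]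
  rw [← h0, ← h1, ← two_mul, lintegral_const_mul' _ _ (by simp)] at hadd
  exact ((ENNReal.mul_right_inj (by simp) (by simp)).mp hadd).symm

end Isogeny

/-! ### Equality of increments in the parameter -/

lemma lintegral_deriv_fiber_eq {k : ℝ} (hk : 3 < k) :
    ∫⁻ t, ENNReal.ofReal (|cos t| / √((k * |cos t|) ^ 2 - (4 * cos t ^ 2 - 1) ^ 2)) ∂angleMeasure
      = ∫⁻ t, ENNReal.ofReal (1 / √(k ^ 2 + 16 * (cos t * cos (3 * t)))) ∂angleMeasure := by
  have hP := lintegral_comp_cos_sq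
    (G := fun s ↦ ENNReal.ofReal (√s / √(k ^ 2 * s - (4 * s - 1) ^ 2))) (by fun_prop)
  have hR := lintegral_comp_cos_sq
    (G := fun s ↦ ENNReal.ofReal (1 / √(k ^ 2 - 48 * s + 64 * s ^ 2))) (by fun_prop)
  have eP : ∀ t, ENNReal.ofReal (|cos t| / √((k * |cos t|) ^ 2 - (4 * cos t ^ 2 - 1) ^ 2))
      = ENNReal.ofReal (√(cos t ^ 2) / √(k ^ 2 * cos t ^ 2 - (4 * cos t ^ 2 - 1) ^ 2)) :=
    fun t ↦ by rw [sqrt_sq_eq_abs, mul_pow, sq_abs]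
  have eR : ∀ t, ENNReal.ofReal (1 / √(k ^ 2 + 16 * (cos t * cos (3 * t))))
      = ENNReal.ofReal (1 / √(k ^ 2 - 48 * cos t ^ 2 + 64 * (cos t ^ 2) ^ 2)) := fun t ↦ by
    rw [cos_three_mul]; congr 3; ring
  rw [lintegral_congr eP, lintegral_congr eR, hP, hR]
  congr 1
  have dP : ∀ s ∈ Ioo (0 : ℝ) 1, ENNReal.ofReal (1 / √(s * (1 - s))) *
      ENNReal.ofReal (√s / √(k ^ 2 * s - (4 * s - 1) ^ 2)) = densityP k s := by
    intro s hs
    have h1 := sqrt_pos.mpr hs.1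
    rw [densityP, ← ENNReal.ofReal_mul (by positivity), sqrt_mul hs.1.le, div_mul_div_comm,
      one_mul, mul_assoc, div_mul_cancel_left₀ h1.ne', one_div]
  have dR : ∀ s ∈ Ioo (0 : ℝ) 1, ENNReal.ofReal (1 / √(s * (1 - s))) *
      ENNReal.ofReal (1 / √(k ^ 2 - 48 * s + 64 * s ^ 2)) = densityR k s := by
    intro s hs
    rw [densityR, ← ENNReal.ofReal_mul (by positivity), div_mul_div_comm, one_mul]
  rw [setLIntegral_congr_fun measurableSet_Ioo dP, setLIntegral_congr_fun measurableSet_Ioo dR]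
  exact lintegral_densityP_eq_lintegral_densityR hk

lemma cos_ne_zero_and_four_cos_sq_ne_ae :
    ∀ᵐ t ∂angleMeasure, cos t ≠ 0 ∧ 4 * cos t ^ 2 - 1 ≠ 0 := by
  filter_upwards [cos_ae_ne_zero_and_integrable.1,
    four_cos_sq_sub_one_ae_ne_zero_and_integrable.1] with t h1 h2
  exact ⟨(mul_ne_zero_iff.mp h1).2, h2⟩

lemma lintegral_fiber_sub_eq {k K : ℝ} (hk : 3 < k) (hK : k ≤ K) :
    ∫⁻ t, ENNReal.ofReal (fiberP K t - fiberP k t) ∂angleMeasure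
      = ∫⁻ t, ENNReal.ofReal (fiberR K t - fiberR k t) ∂angleMeasure := by
  have eP : ∫⁻ t, ENNReal.ofReal (fiberP K t - fiberP k t) ∂angleMeasure
      = ∫⁻ t, (∫⁻ x in Ioc k K, ENNReal.ofReal
        (|cos t| / √((x * |cos t|) ^ 2 - (4 * cos t ^ 2 - 1) ^ 2))) ∂angleMeasure := by
    refine lintegral_congr_ae ?_
    filter_upwards [cos_ne_zero_and_four_cos_sq_ne_ae] with t ht
    exact (lintegral_deriv_fiberP (by linarith) hK ht.1 ht.2).symm
  rw [eP, lintegral_congr fun t ↦ (lintegral_deriv_fiberR hk hK t).symm]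
  -- Tonelli on both sides; for each fixed parameter the inner `t`-integrals agree by the isogeny.
  refine (lintegral_lintegral_swap (by fun_prop)).trans (Eq.trans ?_
    (lintegral_lintegral_swap (by fun_prop)).symm)
  exact setLIntegral_congr_fun measurableSet_Ioc fun x hx ↦
    lintegral_deriv_fiber_eq (hk.trans hx.1)

lemma fiberP_mono {k K t : ℝ} (hK : k ≤ K) (hb : 4 * cos t ^ 2 - 1 ≠ 0) :
    fiberP k t ≤ fiberP K t := by
  have hb' := abs_pos.mpr hb
  have h1 : max (k * |cos t|) |4 * cos t ^ 2 - 1| ≤ max (K * |cos t|) |4 * cos t ^ 2 - 1| := by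
    gcongr
  have h2 : 0 < max (k * |cos t|) |4 * cos t ^ 2 - 1| := lt_max_of_lt_right hb'
  refine Real.log_le_log (by positivity) ?_
  gcongr

lemma fiberR_mono {k K t : ℝ} (hk : 0 < k) (hK : k ≤ K) : fiberR k t ≤ fiberR K t := by
  refine Real.log_le_log (by positivity) ?_
  gcongr

lemma integral_fiber_sub_eq {k K : ℝ} (hk : 16 / (3 * √3) ≤ k) (hk3 : 3 < k) (hK : k ≤ K) :
    ∫ t, fiberP K t ∂angleMeasure - ∫ t, fiberP k t ∂angleMeasure
      = ∫ t, fiberR K t ∂angleMeasure - ∫ t, fiberR k t ∂angleMeasure := by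
  have hk0 : 0 < k := by linarith
  have ak := abs_of_pos hk0
  have aK := abs_of_pos (hk0.trans_le hK)
  have iPk := (polyP_mahler k).2.2
  have iPK := (polyP_mahler K).2.2
  have iRk := (polyR_mahler (k := k) (by rwa [ak])).2.2
  have iRK := (polyR_mahler (k := K) (by rw [aK]; linarith)).2.2
  rw [ak] at iPk iRk
  rw [aK] at iPK iRK
  rw [← integral_sub iPK iPk, ← integral_sub iRK iRk,
    integral_eq_lintegral_of_nonneg_ae (f := fun t ↦ fiberP K t - fiberP k t) _ (iPK.sub iPk).1,
    integral_eq_lintegral_of_nonneg_ae (f := fun t ↦ fiberR K t - fiberR k t) _ (iRK.sub iRk).1,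
    lintegral_fiber_sub_eq hk3 hK]
  · exact Eventually.of_forall fun t ↦ sub_nonneg.mpr (fiberR_mono hk0 hK)
  · filter_upwards [cos_ne_zero_and_four_cos_sq_ne_ae] with t ht
    exact sub_nonneg.mpr (fiberP_mono hK ht.2)

/-! ### Asymptotics for a large parameter -/

lemma tendsto_log_one_add_sqrt {f : ℝ → ℝ} (hf : Tendsto f atTop (𝓝 0)) :
    Tendsto (fun K ↦ Real.log ((1 + √(1 + f K)) / 2)) atTop (𝓝 0) := by
  have hc : ContinuousAt (fun x : ℝ ↦ Real.log ((1 + √(1 + x)) / 2)) 0 := by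
    refine ContinuousAt.log (by fun_prop) (by simp)
  have h := hc.tendsto.comp hf
  have e : Real.log ((1 + √(1 + 0)) / 2) = 0 := by norm_num
  rw [e] at h
  exact h

lemma tendsto_const_div_sq_atTop (q : ℝ) : Tendsto (fun K : ℝ ↦ q / K ^ 2) atTop (𝓝 0) :=
  tendsto_const_nhds.div_atTop (tendsto_pow_atTop two_ne_zero)

lemma abs_sixteen_cos_mul_cos_le (t : ℝ) : |16 * (cos t * cos (3 * t))| ≤ 16 := by
  rw [abs_mul, abs_mul, abs_of_pos (by norm_num : (0 : ℝ) < 16)]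
  have := mul_le_one₀ (abs_cos_le_one t) (abs_nonneg _) (abs_cos_le_one (3 * t))
  linarith

lemma fiberR_sub_log {K : ℝ} (hK : 0 < K) (t : ℝ) :
    fiberR K t - Real.log K
      = Real.log ((1 + √(1 + 16 * (cos t * cos (3 * t)) / K ^ 2)) / 2) := by
  have h : K ^ 2 + 16 * (cos t * cos (3 * t))
      = K ^ 2 * (1 + 16 * (cos t * cos (3 * t)) / K ^ 2) := by field_simp
  rw [fiberR, h, sqrt_mul (by positivity), sqrt_sq hK.le, ← Real.log_div (by positivity) hK.ne']
  congr 1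
  field_simp

lemma tendsto_integral_fiberR_sub_log :
    Tendsto (fun K ↦ ∫ t, (fiberR K t - Real.log K) ∂angleMeasure) atTop (𝓝 0) := by
  have h := tendsto_integral_filter_of_dominated_convergence (μ := angleMeasure)
    (F := fun (K : ℝ) t ↦ fiberR K t - Real.log K) (l := atTop) (f := fun _ ↦ (0 : ℝ))
    (fun _ ↦ Real.log 2) ?_ ?_ (integrable_const _) ?_
  · simpa using h
  · refine Eventually.of_forall fun K ↦ Measurable.aestronglyMeasurable ?_
    unfold fiberR
    fun_prop
  -- For `K ≥ 4` the perturbation `16 cos t cos 3t / K²` is at most `1` in absolute value, so the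
  -- argument of the logarithm stays in `[1/2, 2]`.
  · filter_upwards [eventually_ge_atTop 4] with K hK
    refine Eventually.of_forall fun t ↦ ?_
    rw [fiberR_sub_log (by linarith), Real.norm_eq_abs]
    have hq := abs_sixteen_cos_mul_cos_le t
    have h1 : 16 * (cos t * cos (3 * t)) / K ^ 2 ≤ 1 := by
      rw [div_le_one (by positivity)]
      nlinarith [le_abs_self (16 * (cos t * cos (3 * t)))]
    have h2 : √(1 + 16 * (cos t * cos (3 * t)) / K ^ 2) ≤ 2 := by
      rw [sqrt_le_left (by norm_num)]; linarith
    have h3 := sqrt_nonneg (1 + 16 * (cos t * cos (3 * t)) / K ^ 2)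
    rw [abs_le, ← Real.log_inv]
    exact ⟨Real.log_le_log (by norm_num) (by linarith), Real.log_le_log (by linarith) (by linarith)⟩
  · refine Eventually.of_forall fun t ↦ ?_
    refine (tendsto_log_one_add_sqrt (tendsto_const_div_sq_atTop (16 * (cos t * cos (3 * t))))).congr' ?_
    filter_upwards [eventually_gt_atTop 0] with K hK
    exact (fiberR_sub_log hK t).symm

lemma tendsto_fiberP_sub_log {t : ℝ} (hc : cos t ≠ 0) :
    Tendsto (fun K ↦ fiberP K t - Real.log K - Real.log |2 * cos t|) atTop (𝓝 0) := by
  have hc' := abs_pos.mpr hc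
  refine (tendsto_log_one_add_sqrt (tendsto_const_div_sq_atTop
    (-((4 * cos t ^ 2 - 1) ^ 2 / |cos t| ^ 2)))).congr' ?_
  filter_upwards [eventually_gt_atTop 0, eventually_ge_atTop (|4 * cos t ^ 2 - 1| / |cos t|)]
    with K hK hK2
  rw [div_le_iff₀ hc'] at hK2
  rw [fiberP, max_eq_left hK2]
  generalize 4 * cos t ^ 2 - 1 = b
  rw [abs_mul, abs_two]
  generalize |cos t| = c at hc' ⊢
  have h : (K * c) ^ 2 - b ^ 2 = (K * c) ^ 2 * (1 + -(b ^ 2 / c ^ 2) / K ^ 2) := by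
    field_simp; ring
  rw [h, sqrt_mul (by positivity), sqrt_sq (by positivity), ← Real.log_div (by positivity) hK.ne',
    ← Real.log_div (by positivity) (by positivity)]
  congr 1
  field_simp

/-- Domination for the limit. The `max` lies between `K |cos t|` and `3K`, and adding the square
root at most doubles it, whence the `6`. -/
lemma abs_fiberP_sub_log_le {K t : ℝ} (hK : 1 ≤ K) (hc : cos t ≠ 0) :
    abs (fiberP K t - Real.log K - Real.log |2 * cos t|) ≤ Real.log 6 + abs (Real.log |2 * cos t|) := by
  have hc' := abs_pos.mpr hc
  have hc1 := abs_cos_le_one t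
  have hM : max (K * |cos t|) |4 * cos t ^ 2 - 1| ≤ 3 * K := by
    refine max_le (by nlinarith) (abs_le.mpr ⟨?_, ?_⟩) <;> nlinarith [cos_sq_le_one t, sq_nonneg (cos t)]
  have hM1 : K * |cos t| ≤ max (K * |cos t|) |4 * cos t ^ 2 - 1| := le_max_left _ _
  rw [fiberP]
  generalize max (K * |cos t|) |4 * cos t ^ 2 - 1| = M at hM hM1 ⊢
  have hM0 : 0 < M := (by positivity : 0 < K * |cos t|).trans_le hM1
  have hs : √(M ^ 2 - (4 * cos t ^ 2 - 1) ^ 2) ≤ M := by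
    rw [sqrt_le_left hM0.le]; linarith [sq_nonneg (4 * cos t ^ 2 - 1)]
  have hs0 := sqrt_nonneg (M ^ 2 - (4 * cos t ^ 2 - 1) ^ 2)
  have hup : Real.log (M + √(M ^ 2 - (4 * cos t ^ 2 - 1) ^ 2)) ≤ Real.log 6 + Real.log K := by
    rw [← Real.log_mul (by norm_num) (by positivity)]
    exact Real.log_le_log (by positivity) (by linarith)
  have hlow : Real.log K + Real.log |2 * cos t| - Real.log 2
      ≤ Real.log (M + √(M ^ 2 - (4 * cos t ^ 2 - 1) ^ 2)) := by
    rw [abs_mul, abs_two, Real.log_mul two_ne_zero hc'.ne', add_comm (Real.log 2), ← add_assoc,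
      add_sub_cancel_right, ← Real.log_mul (by positivity) hc'.ne']
    exact Real.log_le_log (by positivity) (by linarith)
  have h26 : Real.log 2 ≤ Real.log 6 := Real.log_le_log (by norm_num) (by norm_num)
  have ha := neg_abs_le (Real.log |2 * cos t|)
  have ha2 := abs_nonneg (Real.log |2 * cos t|)
  rw [abs_le]
  constructor <;> linarith

lemma tendsto_integral_fiberP_sub_log :
    Tendsto (fun K ↦ ∫ t, (fiberP K t - Real.log K - Real.log |2 * cos t|) ∂angleMeasure)
      atTop (𝓝 0) := by
  have h := tendsto_integral_filter_of_dominated_convergence (μ := angleMeasure)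
    (F := fun (K : ℝ) t ↦ fiberP K t - Real.log K - Real.log |2 * cos t|) (l := atTop)
    (f := fun _ ↦ (0 : ℝ)) (fun t ↦ Real.log 6 + abs (Real.log |2 * cos t|)) ?_ ?_
    ((integrable_const _).add cos_ae_ne_zero_and_integrable.2.abs) ?_
  · simpa using h
  · refine Eventually.of_forall fun K ↦ Measurable.aestronglyMeasurable ?_
    unfold fiberP
    fun_prop
  · filter_upwards [eventually_ge_atTop 1] with K hK
    filter_upwards [cos_ne_zero_and_four_cos_sq_ne_ae] with t ht
    exact abs_fiberP_sub_log_le hK ht.1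
  · filter_upwards [cos_ne_zero_and_four_cos_sq_ne_ae] with t ht
    exact tendsto_fiberP_sub_log ht.1

/-! ### Conclusion: a constant difference with limit zero -/

lemma integral_fiberP_eq_integral_fiberR {k : ℝ} (hk : 16 / (3 * √3) ≤ k) :
    ∫ t, fiberP k t ∂angleMeasure = ∫ t, fiberR k t ∂angleMeasure := by
  -- The threshold is about `3.079`, so the strict bound required by the isogeny also holds at the
  -- endpoint.
  have hk3 : 3 < k := by
    refine lt_of_lt_of_le ?_ hk
    rw [lt_div_iff₀ (by positivity)]
    have : √3 < 16 / 9 := by rw [sqrt_lt' (by norm_num)]; norm_num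
    linarith
  have hlim := tendsto_integral_fiberP_sub_log.sub tendsto_integral_fiberR_sub_log
  rw [sub_zero] at hlim
  have hconst : (fun K ↦ ∫ t, (fiberP K t - Real.log K - Real.log |2 * cos t|) ∂angleMeasure
      - ∫ t, (fiberR K t - Real.log K) ∂angleMeasure) =ᶠ[atTop]
      fun _ ↦ ∫ t, fiberP k t ∂angleMeasure - ∫ t, fiberR k t ∂angleMeasure := by
    filter_upwards [eventually_ge_atTop k] with K hK
    have aK : |K| = K := abs_of_pos (by linarith)
    have iP := (polyP_mahler K).2.2
    have iR := (polyR_mahler (k := K) (by rw [aK]; linarith)).2.2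
    rw [aK] at iP iR
    rw [integral_sub (f := fun t ↦ fiberP K t - Real.log K) (iP.sub (integrable_const _))
      cos_ae_ne_zero_and_integrable.2,
      integral_log_abs_two_mul_cos, integral_sub iP (integrable_const _),
      integral_sub iR (integrable_const _)]
    linarith [integral_fiber_sub_eq hk hk3 hK]
  exact sub_eq_zero.mp (tendsto_nhds_unique (tendsto_const_nhds.congr' hconst.symm) hlim)

end

theorem theorem2 (k : ℝ) (hk : 16 / (3 * Real.sqrt 3) ≤ |k|) :
    MeasureTheory.IntegrableOn (logNormOnTorus (polyP k)) torusAngles ∧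
    MeasureTheory.IntegrableOn (logNormOnTorus (polyR k)) torusAngles ∧
    logMahlerMeasure₂ (polyP k) = logMahlerMeasure₂ (polyR k) := by
  obtain ⟨hP, eP, -⟩ := polyP_mahler k
  obtain ⟨hR, eR, -⟩ := polyR_mahler hk
  exact ⟨hP, hR, by rw [eP, eR, integral_fiberP_eq_integral_fiberR hk]⟩
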